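/- For a polynomial $h\in\mathbb{C}[z]$ let $K_h$ be the set of all $z\in\mathbb{C}$ whose forward orbit $z, h(z), h(h(z)),\dots$ is bounded, and let $J_h=\partial K_h$ be its Julia set. Proposition 1. Let $f(z)=az^n+\cdots$ and $g(z)=bz^m+\cdots$ (with $a,b\neq 0$) be complex polynomials of degrees $n,m\ge 2$ with the same Julia set, $J_f=J_g$. Put $L_f(z)=az^n$ and $L_g(z)=bz^m$. Then there is a unique function $\phi$, analytic in a punctured neighbourhood of infinity in $\mathbb{C}$, with a convergent power series expansion $$\phi(z)=z+b_0+\frac{b_1}{z}+\frac{b_2}{z^2}+\cdots$$ there, such that $$\phi\circ f=L_f\circ\phi\qquad\text{and}\qquad \phi\circ g=L_g\circ\phi$$ near infinity. Uniqueness means that any two such functions agree in some neighbourhood of infinity. -/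

import Mathlib

open Filter Bornology

/-- The filled-in Julia set of a complex polynomial: the points with bounded forward orbit. -/
def filledJulia (f : Polynomial ℂ) : Set ℂ :=
  {z | IsBounded (Set.range fun k : ℕ => (fun w : ℂ => f.eval w)^[k] z)}

/-- The Julia set of a complex polynomial: the boundary of its filled-in Julia set. -/
def juliaSet (f : Polynomial ℂ) : Set ℂ :=
  frontier (filledJulia f)

/-- `φ` is analytic in a (punctured) neighbourhood of infinity and has there a convergent
expansion `φ z = z + b 0 + b 1 / z + b 2 / z ^ 2 + ⋯`. -/
def AnalyticTangentToIdAtInfty (φ : ℂ → ℂ) : Prop :=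
  (∀ᶠ z in cobounded ℂ, AnalyticAt ℂ φ z) ∧
    ∃ b : ℕ → ℂ, ∀ᶠ z in cobounded ℂ, HasSum (fun k : ℕ => b k / z ^ k) (φ z - z)

/-- Near infinity, `φ ∘ f = L ∘ φ`, where `L w = a * w ^ n` is the leading term of `f`. -/
def ConjugatesToLeadingTerm (φ : ℂ → ℂ) (f : Polynomial ℂ) : Prop :=
  ∀ᶠ z in cobounded ℂ, φ (f.eval z) = f.leadingCoeff * φ z ^ f.natDegree

open Topology

/-! Each of `f`, `g` has its own Böttcher map at infinity (`exists_conjugatesToLeadingTerm`); the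
point is that the two coincide. If `φ` conjugates `f` to `a z^n`, then `log |φ| + log |a| / (n - 1)`
is the escape rate `lim n^(-k) log |f^k|`, the Green function of the complement of the filled Julia
set `K`. By the maximum principle `J` determines `K`, and a Bernstein–Walsh comparison of iterates
(`escapeRate_le_of_filledJulia_eq`) shows that `K` determines the escape rate. Hence the two
Böttcher maps have a quotient of constant modulus near infinity; it tends to `1` there, so it is
`1`. The case `f = g` gives uniqueness. -/

/-! ### Escape radii and filled Julia sets -/

/-- Outside the ball of radius `R`, the polynomial map at least doubles the modulus. -/
def IsEscapeRadius (f : Polynomial ℂ) (R : ℝ) : Prop :=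
  0 < R ∧ ∀ z : ℂ, R ≤ ‖z‖ → 2 * ‖z‖ ≤ ‖f.eval z‖

/-- Orbits starting outside the radius stay outside, so `P` then holds along whole orbits. -/
theorem exists_isEscapeRadius_of_eventually {f : Polynomial ℂ} (hf : 2 ≤ f.natDegree)
    {P : ℂ → Prop} (hP : ∀ᶠ z in cobounded ℂ, P z) :
    ∃ R, IsEscapeRadius f R ∧ ∀ z : ℂ, R ≤ ‖z‖ → P z := by
  have hlt : (Polynomial.X : Polynomial ℂ).degree < f.degree := by
    rw [Polynomial.degree_X, Polynomial.degree_eq_natDegree (by rintro rfl; simp at hf)]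
    exact_mod_cast hf
  have ho := (Polynomial.isLittleO_cobounded_of_degree_lt hlt).bound (c := 1 / 2) (by norm_num)
  obtain ⟨R, -, hR⟩ := (Metric.hasBasis_cobounded_compl_ball (0 : ℂ)).eventually_iff.1 (ho.and hP)
  have key : ∀ z : ℂ, max R 1 ≤ ‖z‖ → _ := fun z hz =>
    hR (x := z) (by simpa using (le_max_left _ _).trans hz)
  refine ⟨max R 1, ⟨by positivity, fun z hz => ?_⟩, fun z hz => (key z hz).2⟩
  have := (key z hz).1
  simp only [Polynomial.eval_X] at this
  linarith

theorem exists_isEscapeRadius {f : Polynomial ℂ} (hf : 2 ≤ f.natDegree) :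
    ∃ R, IsEscapeRadius f R :=
  let ⟨R, hR, _⟩ := exists_isEscapeRadius_of_eventually hf (P := fun _ => True) (by simp)
  ⟨R, hR⟩

theorem IsEscapeRadius.le_norm_iterate {f : Polynomial ℂ} {R : ℝ} (h : IsEscapeRadius f R)
    {z : ℂ} (hz : R ≤ ‖z‖) (k : ℕ) : 2 ^ k * ‖z‖ ≤ ‖(fun w : ℂ => f.eval w)^[k] z‖ := by
  induction k with
  | zero => simp
  | succ k ih =>
    rw [Function.iterate_succ_apply']
    have h1 : ‖z‖ ≤ 2 ^ k * ‖z‖ :=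
      le_mul_of_one_le_left (norm_nonneg _) (one_le_pow₀ (by norm_num))
    have := h.2 _ (hz.trans (h1.trans ih))
    rw [pow_succ]
    linarith

theorem IsEscapeRadius.radius_le_norm_iterate {f : Polynomial ℂ} {R : ℝ} (h : IsEscapeRadius f R)
    {z : ℂ} (hz : R ≤ ‖z‖) (k : ℕ) : R ≤ ‖(fun w : ℂ => f.eval w)^[k] z‖ :=
  (hz.trans (le_mul_of_one_le_left (norm_nonneg _) (one_le_pow₀ (by norm_num)))).trans
    (h.le_norm_iterate hz k)

theorem IsEscapeRadius.mem_filledJulia_iff {f : Polynomial ℂ} {R : ℝ} (h : IsEscapeRadius f R)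
    {z : ℂ} : z ∈ filledJulia f ↔ ∀ k, ‖(fun w : ℂ => f.eval w)^[k] z‖ ≤ R := by
  refine ⟨fun hz k => ?_, fun hz => ?_⟩
  · by_contra! hk
    rw [filledJulia, Set.mem_ofPred_eq, isBounded_iff_forall_norm_le] at hz
    obtain ⟨C, hC⟩ := hz
    obtain ⟨j, hj⟩ := pow_unbounded_of_one_lt (C / R) (by norm_num : (1 : ℝ) < 2)
    have h1 := h.le_norm_iterate hk.le j
    rw [← Function.iterate_add_apply] at h1
    have h2 := hC _ (Set.mem_range_self (j + k))
    rw [div_lt_iff₀ h.1] at hj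
    have : (2 : ℝ) ^ j * R ≤ 2 ^ j * ‖(fun w : ℂ => f.eval w)^[k] z‖ := by gcongr
    linarith
  · rw [filledJulia, Set.mem_ofPred_eq, isBounded_iff_forall_norm_le]
    exact ⟨R, by rintro _ ⟨k, rfl⟩; exact hz k⟩

theorem differentiable_iterate_eval (f : Polynomial ℂ) (k : ℕ) :
    Differentiable ℂ (fun w : ℂ => f.eval w)^[k] :=
  f.differentiable.iterate k

theorem continuous_iterate_eval (f : Polynomial ℂ) (k : ℕ) :
    Continuous (fun w : ℂ => f.eval w)^[k] :=
  (differentiable_iterate_eval f k).continuous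

theorem IsEscapeRadius.isClosed_filledJulia {f : Polynomial ℂ} {R : ℝ}
    (h : IsEscapeRadius f R) : IsClosed (filledJulia f) := by
  have : filledJulia f = ⋂ k, {z | ‖(fun w : ℂ => f.eval w)^[k] z‖ ≤ R} := by
    ext z; simp [h.mem_filledJulia_iff]
  rw [this]
  exact isClosed_iInter fun k =>
    isClosed_le (continuous_iterate_eval f k).norm continuous_const

theorem IsEscapeRadius.isBounded_filledJulia {f : Polynomial ℂ} {R : ℝ}
    (h : IsEscapeRadius f R) : IsBounded (filledJulia f) :=
  isBounded_iff_forall_norm_le.2 ⟨R, fun _ hz => h.mem_filledJulia_iff.1 hz 0⟩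

/-- Maximum principle for the iterates of `g` on `filledJulia f`: its frontier lies in `filledJulia
g`, where they are bounded by `S`. -/
theorem filledJulia_subset_of_juliaSet_eq {f g : Polynomial ℂ} (hf : 2 ≤ f.natDegree)
    (hg : 2 ≤ g.natDegree) (hJ : juliaSet f = juliaSet g) : filledJulia f ⊆ filledJulia g := by
  obtain ⟨R, hR⟩ := exists_isEscapeRadius hf
  obtain ⟨S, hS⟩ := exists_isEscapeRadius hg
  intro z hz
  rw [hS.mem_filledJulia_iff]
  intro k
  refine Complex.norm_le_of_forall_mem_frontier_norm_le hR.isBounded_filledJulia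
    (differentiable_iterate_eval g k).diffContOnCl (fun w hw => ?_) (subset_closure hz)
  have : w ∈ frontier (filledJulia g) := by
    change w ∈ juliaSet f at hw
    rwa [hJ] at hw
  exact hS.mem_filledJulia_iff.1 (hS.isClosed_filledJulia.frontier_subset this) k

theorem filledJulia_eq_of_juliaSet_eq {f g : Polynomial ℂ} (hf : 2 ≤ f.natDegree)
    (hg : 2 ≤ g.natDegree) (hJ : juliaSet f = juliaSet g) : filledJulia f = filledJulia g :=
  (filledJulia_subset_of_juliaSet_eq hf hg hJ).antisymm
    (filledJulia_subset_of_juliaSet_eq hg hf hJ.symm)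

/-- These compact sets decrease to `filledJulia g`. -/
theorem exists_sublevel_subset {g : Polynomial ℂ} {S : ℝ} (hS : IsEscapeRadius g S) {U : Set ℂ}
    (hU : IsOpen U) (hKU : filledJulia g ⊆ U) :
    ∃ j₀, ∀ j ≥ j₀, {z | ‖(fun w : ℂ => g.eval w)^[j] z‖ ≤ S} ⊆ U := by
  set V : ℕ → Set ℂ := fun j => {z | ‖(fun w : ℂ => g.eval w)^[j] z‖ ≤ S} with hV
  have hanti : Antitone V := by
    refine antitone_nat_of_succ_le fun j z hz => ?_
    simp only [hV, Set.mem_ofPred_eq, Function.iterate_succ_apply'] at hz ⊢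
    by_contra! hlt
    linarith [hS.2 _ hlt.le, hS.1]
  have hclosed : ∀ j, IsClosed (V j) := fun j =>
    isClosed_le (continuous_iterate_eval g j).norm continuous_const
  have hcpt : ∀ j, IsCompact (V j) := fun j =>
    Metric.isCompact_of_isClosed_isBounded (hclosed j)
      (isBounded_iff_forall_norm_le.2 ⟨S, fun z hz => hanti (Nat.zero_le j) hz⟩)
  obtain ⟨j₀, hj₀⟩ := exists_subset_nhds_of_isCompact (directed_of_isDirected_le hanti) hcpt
    (U := U) (fun x hx => hU.mem_nhds (hKU (hS.mem_filledJulia_iff.2 (by simpa [hV] using hx))))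
  exact ⟨j₀, fun j hj => (hanti hj).trans hj₀⟩

/-! ### Bernstein–Walsh and comparison of escape rates -/

/-- Maximum principle for `p / q` outside the lemniscate, cut off by a large disc: the degree gap
makes the quotient small on the outer circle. -/
theorem norm_eval_mul_le_of_degree_lt {p q : Polynomial ℂ} (hdeg : p.degree < q.degree) {M r : ℝ}
    (hM : 0 < M) (hr : 0 < r) (h : ∀ z : ℂ, ‖q.eval z‖ = r → ‖p.eval z‖ ≤ M) {z : ℂ}
    (hz : r < ‖q.eval z‖) : ‖p.eval z‖ * r ≤ M * ‖q.eval z‖ := by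
  have ho := (Polynomial.isLittleO_cobounded_of_degree_lt hdeg).bound (c := M / r) (by positivity)
  obtain ⟨T, -, hT⟩ := (Metric.hasBasis_cobounded_compl_ball (0 : ℂ)).eventually_iff.1 ho
  set S := max T (‖z‖ + 1)
  set U : Set ℂ := {w | r < ‖q.eval w‖} ∩ Metric.ball 0 S
  have hopen : IsOpen {w : ℂ | r < ‖q.eval w‖} := isOpen_lt continuous_const q.continuous.norm
  have hcl : closure {w : ℂ | r < ‖q.eval w‖} ⊆ {w | r ≤ ‖q.eval w‖} :=
    closure_minimal (fun w (hw : r < _) => hw.le) (isClosed_le continuous_const q.continuous.norm)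
  have hclU : ∀ w ∈ closure U, r ≤ ‖q.eval w‖ ∧ ‖w‖ ≤ S := fun w hw =>
    ⟨hcl (closure_mono Set.inter_subset_left hw), by
      simpa using Metric.closure_ball_subset_closedBall
        (closure_mono Set.inter_subset_right hw)⟩
  have hd : DiffContOnCl ℂ (fun w => p.eval w / q.eval w) U := by
    refine DifferentiableOn.diffContOnCl fun w hw => ?_
    have : q.eval w ≠ 0 := norm_pos_iff.1 (hr.trans_le (hclU w hw).1)
    exact (p.differentiable.differentiableAt.div
      q.differentiable.differentiableAt this).differentiableWithinAt
  have hb : ∀ w ∈ frontier U, ‖p.eval w / q.eval w‖ ≤ M / r := by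
    intro w hw
    obtain ⟨h1, h2⟩ := hclU w hw.1
    have hq : 0 < ‖q.eval w‖ := hr.trans_le h1
    rw [norm_div, div_le_iff₀ hq]
    have hw2 : w ∉ U := by
      have := hw.2
      rwa [(hopen.inter Metric.isOpen_ball).interior_eq] at this
    rcases h1.eq_or_lt with h1 | h1
    · rw [← h1, div_mul_cancel₀ _ hr.ne']; exact h w h1.symm
    · rcases h2.eq_or_lt with h2 | h2
      · refine hT ?_
        rw [Set.mem_compl_iff, mem_ball_zero_iff, not_lt, h2]
        exact le_max_left _ _
      · exact absurd ⟨h1, by simpa using h2⟩ hw2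
  have hzU : z ∈ U := ⟨hz, mem_ball_zero_iff.2 <|
    lt_of_lt_of_le (lt_add_one ‖z‖) (le_max_right T _)⟩
  have := Complex.norm_le_of_forall_mem_frontier_norm_le
    (Metric.isBounded_ball.subset Set.inter_subset_right) hd hb (subset_closure hzU)
  rwa [norm_div, div_le_div_iff₀ (hr.trans hz) hr] at this

/-- A form of the Bernstein–Walsh inequality for the exterior of a lemniscate. -/
theorem norm_eval_mul_le_of_natDegree_le {p q : Polynomial ℂ} (hdeg : p.natDegree ≤ q.natDegree)
    (hq : 0 < q.natDegree) {M r : ℝ}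
    (hM : 0 < M) (hr : 0 < r) (h : ∀ z : ℂ, ‖q.eval z‖ = r → ‖p.eval z‖ ≤ M) {z : ℂ}
    (hz : r ≤ ‖q.eval z‖) : ‖p.eval z‖ * r ≤ M * ‖q.eval z‖ := by
  rcases hz.eq_or_lt with hz | hz
  · rw [← hz]; exact mul_le_mul_of_nonneg_right (h z hz.symm) hr.le
  have hqz : 0 < ‖q.eval z‖ := hr.trans hz
  -- Comparing `p ^ l` with `q ^ (l + 1)` forces a strict degree gap. A ratio whose powers are all
  -- bounded is at most `1`.
  have key : ∀ l : ℕ, (‖p.eval z‖ * r / (M * ‖q.eval z‖)) ^ l ≤ ‖q.eval z‖ / r := by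
    intro l
    have hlt : (p ^ l).degree < (q ^ (l + 1)).degree := by
      have hq0 : q ^ (l + 1) ≠ 0 := pow_ne_zero _ (by rintro rfl; simp at hq)
      refine Polynomial.degree_lt_degree ?_
      rw [Polynomial.natDegree_pow, Polynomial.natDegree_pow]
      nlinarith
    have := norm_eval_mul_le_of_degree_lt hlt (pow_pos hM l) (pow_pos hr (l + 1))
      (fun w hw => by
        rw [Polynomial.eval_pow, norm_pow] at hw ⊢
        exact pow_le_pow_left₀ (norm_nonneg _)
          (h w ((pow_left_inj₀ (norm_nonneg _) hr.le l.succ_ne_zero).1 hw)) l)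
      (z := z) (by
        rw [Polynomial.eval_pow, norm_pow]
        exact pow_lt_pow_left₀ hz hr.le l.succ_ne_zero)
    simp only [Polynomial.eval_pow, norm_pow] at this
    rw [div_pow, div_le_div_iff₀ (by positivity) hr, mul_pow, mul_pow]
    calc ‖p.eval z‖ ^ l * r ^ l * r = ‖p.eval z‖ ^ l * r ^ (l + 1) := by ring
      _ ≤ _ := this
      _ = _ := by ring
  by_contra! hcon
  obtain ⟨l, hl⟩ := pow_unbounded_of_one_lt (‖q.eval z‖ / r)
    ((one_lt_div (by positivity : 0 < M * ‖q.eval z‖)).2 hcon)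
  exact absurd (key l) (not_le.2 hl)

/-- For fixed `k` and large `j`, the lemniscate `|g^j| = S` lies where `|f^k| < R + 1`.
Bernstein–Walsh bounds `f^k` by `g^j`; take logarithms, let `j → ∞`, then `k → ∞`. -/
theorem escapeRate_le_of_filledJulia_eq {f g : Polynomial ℂ} (hf : 2 ≤ f.natDegree)
    (hg : 2 ≤ g.natDegree) (hK : filledJulia f = filledJulia g) {R S : ℝ}
    (hR : IsEscapeRadius f R) (hS : IsEscapeRadius g S) {z : ℂ} (hzR : R ≤ ‖z‖) (hz : S ≤ ‖z‖)
    {A B : ℝ}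
    (hA : Tendsto (fun k : ℕ => Real.log ‖(fun w : ℂ => f.eval w)^[k] z‖ / f.natDegree ^ k)
      atTop (𝓝 A))
    (hB : Tendsto (fun k : ℕ => Real.log ‖(fun w : ℂ => g.eval w)^[k] z‖ / g.natDegree ^ k)
      atTop (𝓝 B)) : A ≤ B := by
  have hn : (1 : ℝ) < f.natDegree := by exact_mod_cast hf
  have hm : (1 : ℝ) < g.natDegree := by exact_mod_cast hg
  have lim0 : ∀ (x c : ℝ), 1 < x → Tendsto (fun k : ℕ => c / x ^ k) atTop (𝓝 0) := fun x c hx =>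
    tendsto_const_nhds.div_atTop (tendsto_pow_atTop_atTop_of_one_lt hx)
  have hR1 : 0 < R + 1 := by linarith [hR.1]
  have step : ∀ k : ℕ, Real.log ‖(fun w : ℂ => f.eval w)^[k] z‖ / f.natDegree ^ k ≤
      Real.log (R + 1) / f.natDegree ^ k + B := by
    intro k
    obtain ⟨j₀, hj₀⟩ := exists_sublevel_subset hS
      (U := {w | ‖(fun w : ℂ => f.eval w)^[k] w‖ < R + 1})
      (isOpen_lt (continuous_iterate_eval f k).norm continuous_const)
      (fun w hw => by
        rw [← hK] at hw
        exact (hR.mem_filledJulia_iff.1 hw k).trans_lt (lt_add_one R))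
    have hlim := ((hB.const_add (Real.log (R + 1) / f.natDegree ^ k)).sub
      (lim0 _ (Real.log S) hm))
    rw [sub_zero] at hlim
    refine ge_of_tendsto hlim (eventually_atTop.2 ⟨j₀, fun j hj => ?_⟩)
    have hfe : ∀ w : ℂ, (f.comp^[k] Polynomial.X).eval w = (fun w : ℂ => f.eval w)^[k] w :=
      fun w => by rw [Polynomial.iterate_comp_eval, Polynomial.eval_X]
    have hge : ∀ w : ℂ, (g.comp^[j] Polynomial.X).eval w = (fun w : ℂ => g.eval w)^[j] w :=
      fun w => by rw [Polynomial.iterate_comp_eval, Polynomial.eval_X]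
    have hnk : f.natDegree ^ k ≠ 0 := pow_ne_zero _ (by omega)
    have hmj : g.natDegree ^ j ≠ 0 := pow_ne_zero _ (by omega)
    have hSj := hS.radius_le_norm_iterate hz j
    -- The exponents give both polynomials degree `n^k m^j`.
    have main := norm_eval_mul_le_of_natDegree_le
      (p := (f.comp^[k] Polynomial.X) ^ g.natDegree ^ j)
      (q := (g.comp^[j] Polynomial.X) ^ f.natDegree ^ k)
      (M := (R + 1) ^ g.natDegree ^ j) (r := S ^ f.natDegree ^ k) (z := z)
      (by simp only [Polynomial.natDegree_pow, Polynomial.natDegree_iterate_comp,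
            Polynomial.natDegree_X, mul_one]
          exact (mul_comm _ _).le)
      (by simp only [Polynomial.natDegree_pow, Polynomial.natDegree_iterate_comp,
            Polynomial.natDegree_X, mul_one]
          positivity)
      (by positivity) (pow_pos hS.1 _)
      (fun w hw => by
        rw [Polynomial.eval_pow, norm_pow, hge] at hw
        rw [Polynomial.eval_pow, norm_pow, hfe]
        exact pow_le_pow_left₀ (norm_nonneg _) (le_of_lt (hj₀ j hj
          ((pow_left_inj₀ (norm_nonneg _) hS.1.le hnk).1 hw).le)) _)
      (by rw [Polynomial.eval_pow, norm_pow, hge]; exact pow_le_pow_left₀ hS.1.le hSj _)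
    simp only [Polynomial.eval_pow, norm_pow, hfe, hge] at main
    have hfpos := hR.1.trans_le (hR.radius_le_norm_iterate hzR k)
    have hgpos := hS.1.trans_le hSj
    have hSpos := hS.1
    have hlog := Real.log_le_log (by positivity) main
    rw [Real.log_mul (by positivity) (by positivity), Real.log_mul (by positivity) (by positivity),
      Real.log_pow, Real.log_pow, Real.log_pow, Real.log_pow] at hlog
    push_cast at hlog
    have hnk' : (0 : ℝ) < (f.natDegree : ℝ) ^ k := by positivity
    have hmj' : (0 : ℝ) < (g.natDegree : ℝ) ^ j := by positivity
    rw [le_sub_iff_add_le, div_add_div _ _ hnk'.ne' hmj'.ne', div_add_div _ _ hnk'.ne' hmj'.ne']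
    gcongr ?_ / _
    linarith
  have := le_of_tendsto_of_tendsto' hA ((lim0 _ (Real.log (R + 1)) hn).add_const B) step
  simpa using this

/-! ### Germs at infinity in the coordinate `w = 1/z` -/

theorem AnalyticTangentToIdAtInfty.exists_analyticAt {φ : ℂ → ℂ}
    (hφ : AnalyticTangentToIdAtInfty φ) :
    ∃ h : ℂ → ℂ, AnalyticAt ℂ h 0 ∧ h 0 = 1 ∧ ∀ᶠ z in cobounded ℂ, φ z = z * h z⁻¹ := by
  obtain ⟨-, b, hb⟩ := hφ
  set D : ℂ → ℂ := fun w => ∑' k, w ^ k * b k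
  have hsum : ∀ᶠ z in cobounded ℂ, HasSum (fun k => z⁻¹ ^ k * b k) (φ z - z) := by
    filter_upwards [hb] with z hz
    refine hz.congr_fun fun k => ?_
    rw [inv_pow, div_eq_inv_mul]
  have hD : AnalyticAt ℂ D 0 := by
    refine ⟨FormalMultilinearSeries.ofScalars ℂ b, hasFPowerSeriesAt_iff.2 ?_⟩
    have hne : ∀ᶠ w in 𝓝[≠] (0 : ℂ), HasSum (fun k => w ^ k * b k) (D w) := by
      filter_upwards [tendsto_inv₀_nhdsNE_zero.eventually hsum] with w hw
      rw [inv_inv] at hw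
      exact hw.summable.hasSum
    have h0 : HasSum (fun k => (0 : ℂ) ^ k * b k) (D 0) :=
      (by simpa using HasSum.hasSum_at_zero (𝕜 := ℂ) b :
        HasSum (fun k => (0 : ℂ) ^ k * b k) (b 0)).summable.hasSum
    filter_upwards [eventually_nhdsWithin_iff.1 hne] with w hw
    simp only [FormalMultilinearSeries.coeff_ofScalars, zero_add, smul_eq_mul]
    rcases eq_or_ne w 0 with rfl | hw0
    · exact h0
    · exact hw hw0
  refine ⟨fun w => 1 + w * D w, analyticAt_const.add (analyticAt_id.mul hD), by simp, ?_⟩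
  filter_upwards [hsum, eventually_ne_cobounded 0] with z hz hz0
  have : D z⁻¹ = φ z - z := hz.tsum_eq
  simp only [this]
  field_simp
  ring

theorem AnalyticAt.analyticTangentToIdAtInfty {h : ℂ → ℂ} (hh : AnalyticAt ℂ h 0) (h0 : h 0 = 1) :
    AnalyticTangentToIdAtInfty fun z => z * h z⁻¹ := by
  refine ⟨?_, ?_⟩
  · have hev := (tendsto_inv₀_cobounded (α := ℂ)).eventually
      hh.eventually_analyticAt
    filter_upwards [hev, eventually_ne_cobounded 0] with z hz hz0
    exact analyticAt_id.mul (hz.fun_comp (analyticAt_id.inv hz0))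
  · obtain ⟨p, hp⟩ := hh
    have hD := hasFPowerSeriesAt_iff.1 hp.has_fpower_series_dslope_fslope
    refine ⟨p.fslope.coeff, ?_⟩
    filter_upwards [tendsto_inv₀_cobounded.eventually hD, eventually_ne_cobounded 0] with z hz hz0
    -- The expansion of `φ z - z` is that of `(h w - 1) / w`.
    have hval : dslope h 0 (0 + z⁻¹) = z * h z⁻¹ - z := by
      rw [zero_add, dslope_of_ne _ (inv_ne_zero hz0), slope_def_field, h0]
      field_simp
      ring
    rw [← hval]
    refine hz.congr_fun fun k => ?_
    rw [inv_pow, smul_eq_mul, div_eq_inv_mul]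

/-! ### Escape rates determine Böttcher maps -/

theorem eventually_tendsto_escapeRate {φ : ℂ → ℂ} {f : Polynomial ℂ} (hf : 2 ≤ f.natDegree)
    (hφ : AnalyticTangentToIdAtInfty φ) (hφf : ConjugatesToLeadingTerm φ f) :
    ∀ᶠ z in cobounded ℂ,
      Tendsto (fun k : ℕ => Real.log ‖(fun w : ℂ => f.eval w)^[k] z‖ / f.natDegree ^ k) atTop
        (𝓝 (Real.log ‖φ z‖ + Real.log ‖f.leadingCoeff‖ / (f.natDegree - 1))) := by
  obtain ⟨h, hh, h0, hφh⟩ := hφ.exists_analyticAt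
  have hn : (1 : ℝ) < f.natDegree := by exact_mod_cast hf
  have hlead : f.leadingCoeff ≠ 0 := by
    rw [Polynomial.leadingCoeff_ne_zero]; rintro rfl; simp at hf
  have hlog : ∀ᶠ w in 𝓝 (0 : ℂ), h w ≠ 0 ∧ |Real.log ‖h w‖| ≤ 1 := by
    have hne : h 0 ≠ 0 := by simp [h0]
    refine (hh.continuousAt.eventually_ne hne).and ?_
    have hc : ContinuousAt (fun w => |Real.log ‖h w‖|) 0 :=
      (hh.continuousAt.norm.log (by simpa using hne)).abs
    exact (hc.eventually_lt_const (by simp [h0] : |Real.log ‖h 0‖| < 1)).mono fun _ => le_of_lt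
  obtain ⟨R, hR, hP⟩ := exists_isEscapeRadius_of_eventually hf
    ((hφh.and hφf).and (tendsto_inv₀_cobounded.eventually hlog))
  refine (Metric.hasBasis_cobounded_compl_ball (0 : ℂ)).eventually_iff.2 ⟨R, trivial, ?_⟩
  intro z hz
  replace hz : R ≤ ‖z‖ := by simpa using hz
  -- The shift by `c` turns `y ↦ n y + log |a|`, the recursion for `log |φ|` along an orbit, into
  -- multiplication by `n`.
  set c := Real.log ‖f.leadingCoeff‖ / (f.natDegree - 1) with hc
  have hc' : Real.log ‖f.leadingCoeff‖ = (f.natDegree - 1) * c := by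
    rw [hc, mul_div_cancel₀ _ (by linarith)]
  set x : ℕ → ℂ := fun k => (fun w : ℂ => f.eval w)^[k] z with hx
  have hxR : ∀ k, R ≤ ‖x k‖ := hR.radius_le_norm_iterate hz
  have hφx : ∀ k, φ (x k) ≠ 0 := fun k => by
    rw [(hP _ (hxR k)).1.1]
    exact mul_ne_zero (norm_pos_iff.1 (hR.1.trans_le (hxR k))) (hP _ (hxR k)).2.1
  have hy : ∀ k, Real.log ‖φ (x k)‖ + c = f.natDegree ^ k * (Real.log ‖φ z‖ + c) := by
    intro k
    induction k with
    | zero => simp [hx]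
    | succ k ih =>
      have : x (k + 1) = f.eval (x k) := Function.iterate_succ_apply' _ _ _
      rw [this, (hP _ (hxR k)).1.2, norm_mul, norm_pow, Real.log_mul (by simpa using hlead)
        (pow_ne_zero _ (by simpa using hφx k)), Real.log_pow, hc', pow_succ']
      linear_combination (f.natDegree : ℝ) * ih
  have hbd : ∀ k, |Real.log ‖x k‖ - Real.log ‖φ (x k)‖ - c| ≤ 1 + |c| := by
    intro k
    have hxk : ‖x k‖ ≠ 0 := (hR.1.trans_le (hxR k)).ne'
    obtain ⟨⟨h1, -⟩, h2, h3⟩ := hP _ (hxR k)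
    rw [h1, norm_mul, Real.log_mul hxk (by simpa using h2)]
    calc |_| = |-Real.log ‖h (x k)⁻¹‖ - c| := by congr 1; ring
      _ ≤ |-Real.log ‖h (x k)⁻¹‖| + |c| := abs_sub _ _
      _ ≤ 1 + |c| := by rw [abs_neg]; gcongr
  have hlim : Tendsto (fun k : ℕ => (Real.log ‖x k‖ - Real.log ‖φ (x k)‖ - c) / f.natDegree ^ k)
      atTop (𝓝 0) := by
    refine squeeze_zero_norm (a := fun k : ℕ => (1 + |c|) / (f.natDegree : ℝ) ^ k) (fun k => ?_)
      (tendsto_const_nhds.div_atTop (tendsto_pow_atTop_atTop_of_one_lt hn))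
    have hpos : (0 : ℝ) < (f.natDegree : ℝ) ^ k := by positivity
    rw [Real.norm_eq_abs, abs_div, abs_of_pos hpos]
    gcongr
    exact hbd k
  have := hlim.add_const (Real.log ‖φ z‖ + c)
  rw [zero_add] at this
  refine this.congr fun k => ?_
  have hpos : (0 : ℝ) < (f.natDegree : ℝ) ^ k := by positivity
  change _ = Real.log ‖x k‖ / _
  field_simp
  linear_combination -hy k

/-- In `w = 1/z` the quotient `q` is analytic with `q 0 = 1` and constant modulus off `0`. By
continuity that modulus is `1`, so `|q|` has a local maximum at `0` and `q` is constant. -/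
theorem AnalyticTangentToIdAtInfty.eventually_eq {φ ψ : ℂ → ℂ}
    (hφ : AnalyticTangentToIdAtInfty φ) (hψ : AnalyticTangentToIdAtInfty ψ) {C : ℝ}
    (hC : ∀ᶠ z in cobounded ℂ, Real.log ‖φ z‖ - Real.log ‖ψ z‖ = C) :
    ∀ᶠ z in cobounded ℂ, φ z = ψ z := by
  obtain ⟨h₁, ha₁, h₁0, hφh⟩ := hφ.exists_analyticAt
  obtain ⟨h₂, ha₂, h₂0, hψh⟩ := hψ.exists_analyticAt
  have hne₁ : ∀ᶠ w in 𝓝 (0 : ℂ), h₁ w ≠ 0 := ha₁.continuousAt.eventually_ne (by simp [h₁0])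
  have hne₂ : ∀ᶠ w in 𝓝 (0 : ℂ), h₂ w ≠ 0 := ha₂.continuousAt.eventually_ne (by simp [h₂0])
  set q : ℂ → ℂ := fun w => h₁ w / h₂ w with hq
  have hqa : AnalyticAt ℂ q 0 := ha₁.div ha₂ (by simp [h₂0])
  have hq0 : q 0 = 1 := by simp [hq, h₁0, h₂0]
  have hlog : ∀ᶠ w in 𝓝[≠] (0 : ℂ), Real.log ‖q w‖ = C := by
    filter_upwards [tendsto_inv₀_nhdsNE_zero.eventually (hφh.and (hψh.and hC)),
      hne₁.filter_mono nhdsWithin_le_nhds, hne₂.filter_mono nhdsWithin_le_nhds,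
      self_mem_nhdsWithin] with w hw hw₁ hw₂ hw0
    obtain ⟨e₁, e₂, e₃⟩ := hw
    have hw0' : ‖w⁻¹‖ ≠ 0 := norm_ne_zero_iff.2 (inv_ne_zero hw0)
    rw [e₁, e₂, inv_inv, norm_mul, norm_mul, Real.log_mul hw0' (norm_ne_zero_iff.2 hw₁),
      Real.log_mul hw0' (norm_ne_zero_iff.2 hw₂)] at e₃
    rw [hq, norm_div, Real.log_div (norm_ne_zero_iff.2 hw₁) (norm_ne_zero_iff.2 hw₂)]
    linarith
  have hcont : ContinuousAt (fun w => Real.log ‖q w‖) 0 :=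
    hqa.continuousAt.norm.log (by simp [hq0])
  have hC0 : C = 0 := by
    refine tendsto_nhds_unique
      (tendsto_const_nhds.congr' (hlog.mono fun _ hw => hw.symm)) ?_
    simpa [hq0] using hcont.tendsto.mono_left (nhdsWithin_le_nhds (s := {0}ᶜ))
  have hmax : IsLocalMax (norm ∘ q) 0 := by
    filter_upwards [eventually_nhdsWithin_iff.1 hlog, hne₁, hne₂] with w hw hw₁ hw₂
    rcases eq_or_ne w 0 with rfl | hw0
    · exact le_rfl
    · have hpos : 0 < ‖q w‖ := norm_pos_iff.2 (div_ne_zero hw₁ hw₂)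
      have := Real.eq_one_of_pos_of_log_eq_zero hpos ((hw hw0).trans hC0)
      simp [this, hq0]
  have hq1 := Complex.eventually_eq_of_isLocalMax_norm
    (hqa.eventually_analyticAt.mono fun _ h => h.differentiableAt) hmax
  filter_upwards [hφh, hψh, tendsto_inv₀_cobounded.eventually (hq1.and hne₂)] with z h1 h2 h3
  rw [h1, h2]
  have := h3.1
  rw [hq0, hq, div_eq_one_iff_eq h3.2] at this
  rw [this]

theorem eventually_eq_of_filledJulia_eq {f g : Polynomial ℂ} (hf : 2 ≤ f.natDegree)
    (hg : 2 ≤ g.natDegree) (hK : filledJulia f = filledJulia g) {φ ψ : ℂ → ℂ}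
    (hφ : AnalyticTangentToIdAtInfty φ) (hφf : ConjugatesToLeadingTerm φ f)
    (hψ : AnalyticTangentToIdAtInfty ψ) (hψg : ConjugatesToLeadingTerm ψ g) :
    ∀ᶠ z in cobounded ℂ, φ z = ψ z := by
  obtain ⟨R, hR⟩ := exists_isEscapeRadius hf
  obtain ⟨S, hS⟩ := exists_isEscapeRadius hg
  refine hφ.eventually_eq hψ (C := Real.log ‖g.leadingCoeff‖ / (g.natDegree - 1) -
    Real.log ‖f.leadingCoeff‖ / (f.natDegree - 1)) ?_
  filter_upwards [eventually_tendsto_escapeRate hf hφ hφf, eventually_tendsto_escapeRate hg hψ hψg,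
    eventually_cobounded_le_norm R, eventually_cobounded_le_norm S] with z hA hB hzR hzS
  have h1 := escapeRate_le_of_filledJulia_eq hf hg hK hR hS hzR hzS hA hB
  have h2 := escapeRate_le_of_filledJulia_eq hg hf hK.symm hS hR hzS hzR hB hA
  linarith

/-! ### Existence of the Böttcher map -/

/-- Böttcher's theorem at infinity, for a polynomial. -/
theorem exists_conjugatesToLeadingTerm {f : Polynomial ℂ} (hf : 2 ≤ f.natDegree) :
    ∃ φ : ℂ → ℂ, AnalyticTangentToIdAtInfty φ ∧ ConjugatesToLeadingTerm φ f := by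
  have hlead : f.leadingCoeff ≠ 0 := by
    rw [Polynomial.leadingCoeff_ne_zero]; rintro rfl; simp at hf
  set n := f.natDegree with hn
  have hn1 : (1 : ℝ) < n := by exact_mod_cast hf
  have hnC : (n : ℂ) ≠ 0 := by exact_mod_cast (by omega : n ≠ 0)
  set u : ℂ → ℂ := fun w => f.reverse.eval w / f.leadingCoeff with hu
  have hu0 : u 0 = 1 := by
    simp [hu, ← Polynomial.coeff_zero_eq_eval_zero, Polynomial.coeff_zero_reverse, hlead]
  have hud : Differentiable ℂ u := f.reverse.differentiable.div_const _
  have hfu : ∀ z : ℂ, z ≠ 0 → f.eval z = f.leadingCoeff * z ^ n * u z⁻¹ := by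
    intro z hz
    let := invertibleOfNonzero hz
    have := Polynomial.eval₂_reverse_mul_pow (RingHom.id ℂ) z f
    simp only [Polynomial.eval₂_id, invOf_eq_inv] at this
    rw [← this, hu, ← hn]
    field_simp
  set F : ℂ → ℂ := fun w => w ^ n * (f.leadingCoeff * u w)⁻¹ with hF
  have hFinv : ∀ w : ℂ, w ≠ 0 → F w = (f.eval w⁻¹)⁻¹ := by
    intro w hw
    rw [hfu _ (inv_ne_zero hw), inv_inv, hF]
    simp only [inv_pow, mul_inv, inv_inv]
    ring
  have hslit : ∀ᶠ w in 𝓝 (0 : ℂ), u w ∈ Complex.slitPlane :=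
    hud.continuous.continuousAt.eventually_mem
      (Complex.isOpen_slitPlane.mem_nhds (by simp [hu0]))
  have hlogc : ContinuousAt (fun w => ‖Complex.log (u w)‖) 0 :=
    (hud.continuous.continuousAt.clog (by simp [hu0])).norm
  have hlog1 : ∀ᶠ w in 𝓝 (0 : ℂ), ‖Complex.log (u w)‖ < 1 :=
    hlogc.eventually_lt_const (by simp [hu0])
  -- This is `F w / w`, small since `n ≥ 2`; hence `F` preserves a small ball on which `log u` is
  -- bounded.
  have hsmall : ∀ᶠ w in 𝓝 (0 : ℂ), ‖w ^ (n - 1) * (f.leadingCoeff * u w)⁻¹‖ < 1 := by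
    have hc : ContinuousAt (fun w => ‖w ^ (n - 1) * (f.leadingCoeff * u w)⁻¹‖) 0 :=
      ((continuousAt_id.pow _).mul ((continuousAt_const.mul hud.continuous.continuousAt).inv₀
        (by simp [hu0, hlead]))).norm
    refine hc.eventually_lt_const ?_
    simp [zero_pow (by omega : n - 1 ≠ 0)]
  obtain ⟨r, hr, hball⟩ := Metric.eventually_nhds_iff_ball.1 (hslit.and (hlog1.and hsmall))
  have hFmaps : Set.MapsTo F (Metric.ball 0 r) (Metric.ball 0 r) := by
    intro w hw
    have h1 := (hball w hw).2.2
    have : F w = w * (w ^ (n - 1) * (f.leadingCoeff * u w)⁻¹) := by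
      rw [hF, ← mul_assoc, ← pow_succ', Nat.sub_add_cancel (by omega)]
    rw [mem_ball_zero_iff] at hw ⊢
    rw [this, norm_mul]
    exact (mul_le_of_le_one_right (norm_nonneg _) h1.le).trans_lt hw
  have hFd : DifferentiableOn ℂ F (Metric.ball 0 r) := fun w hw => by
    have hne : f.leadingCoeff * u w ≠ 0 :=
      mul_ne_zero hlead (Complex.slitPlane_ne_zero (hball w hw).1)
    exact ((differentiableAt_id.pow n).mul
      ((hud.differentiableAt.const_mul _).inv hne)).differentiableWithinAt
  have hld : DifferentiableOn ℂ (fun w => Complex.log (u w)) (Metric.ball 0 r) := fun w hw =>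
    (hud.differentiableAt.clog (hball w hw).1).differentiableWithinAt
  -- With `φ z = z exp (H z⁻¹)` the conjugacy follows from `n H = log u + H ∘ F`; iterating this
  -- equation gives the series.
  set T : ℕ → ℂ → ℂ := fun k w => Complex.log (u (F^[k] w)) / n ^ (k + 1) with hT
  have hTd : ∀ k, DifferentiableOn ℂ (T k) (Metric.ball 0 r) := fun k =>
    (hld.comp (hFd.iterate hFmaps k) (hFmaps.iterate k)).div_const _
  have hsumm : Summable fun k : ℕ => 1 / (n : ℝ) ^ (k + 1) := by
    have := (summable_nat_add_iff 1).2
      (summable_geometric_of_lt_one (r := (n : ℝ)⁻¹) (by positivity) (inv_lt_one_of_one_lt₀ hn1))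
    simpa [inv_pow] using this
  have hTle : ∀ k, ∀ w ∈ Metric.ball (0 : ℂ) r, ‖T k w‖ ≤ 1 / (n : ℝ) ^ (k + 1) := by
    intro k w hw
    rw [hT, norm_div, norm_pow, Complex.norm_natCast]
    gcongr
    exact (hball _ (hFmaps.iterate k hw)).2.1.le
  set H : ℂ → ℂ := fun w => ∑' k, T k w with hH
  have hHa : AnalyticAt ℂ H 0 :=
    (Complex.differentiableOn_tsum_of_summable_norm hsumm hTd Metric.isOpen_ball
      hTle).analyticAt (Metric.ball_mem_nhds 0 hr)
  have hHF : ∀ w ∈ Metric.ball (0 : ℂ) r, n * H w = Complex.log (u w) + H (F w) := by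
    intro w hw
    have hs : Summable fun k => T k w := hsumm.of_norm_bounded fun k => hTle k w hw
    rw [hH]
    simp only
    rw [hs.tsum_eq_zero_add, mul_add, ← tsum_mul_left]
    congr 1
    · simp only [hT, Function.iterate_zero, id, zero_add, pow_one]
      field_simp
    · refine tsum_congr fun k => ?_
      simp only [hT, Function.iterate_succ_apply]
      rw [pow_succ' (n : ℂ) (k + 1)]
      field_simp
  have hF0 : F 0 = 0 := by simp [hF, zero_pow (by omega : n ≠ 0)]
  have hH0 : H 0 = 0 := by
    simp only [hH, hT, Function.iterate_fixed hF0, hu0, Complex.log_one, zero_div, tsum_zero]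
  refine ⟨fun z => z * Complex.exp (H z⁻¹), AnalyticAt.analyticTangentToIdAtInfty
    (h := fun w => Complex.exp (H w)) hHa.cexp (by simp [hH0]), ?_⟩
  filter_upwards [tendsto_inv₀_cobounded.eventually (Metric.ball_mem_nhds (0 : ℂ) hr),
    eventually_ne_cobounded 0] with z hz hz0
  have hu_ne : u z⁻¹ ≠ 0 := Complex.slitPlane_ne_zero (hball _ hz).1
  have hHz := hHF _ hz
  rw [hFinv _ (inv_ne_zero hz0), inv_inv] at hHz
  rw [mul_pow, ← Complex.exp_nat_mul, hHz, Complex.exp_add, Complex.exp_log hu_ne]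
  nth_rewrite 1 [hfu z hz0]
  ring

/-! ### Conclusion -/

theorem proposition1 (f g : Polynomial ℂ) (hf : 2 ≤ f.natDegree) (hg : 2 ≤ g.natDegree)
    (hJ : juliaSet f = juliaSet g) :
    ∃ φ : ℂ → ℂ,
      (AnalyticTangentToIdAtInfty φ ∧ ConjugatesToLeadingTerm φ f ∧
        ConjugatesToLeadingTerm φ g) ∧
      ∀ ψ : ℂ → ℂ,
        AnalyticTangentToIdAtInfty ψ → ConjugatesToLeadingTerm ψ f →
          ConjugatesToLeadingTerm ψ g → ∀ᶠ z in cobounded ℂ, ψ z = φ z := by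
  obtain ⟨φ, hφ, hφf⟩ := exists_conjugatesToLeadingTerm hf
  obtain ⟨χ, hχ, hχg⟩ := exists_conjugatesToLeadingTerm hg
  have heq := eventually_eq_of_filledJulia_eq hf hg (filledJulia_eq_of_juliaSet_eq hf hg hJ)
    hφ hφf hχ hχg
  refine ⟨φ, ⟨hφ, hφf, ?_⟩, fun ψ hψ hψf _ => eventually_eq_of_filledJulia_eq hf hf rfl
    hψ hψf hφ hφf⟩
  -- Transferring the conjugacy from `χ` to `φ` needs `φ = χ` at both `z` and `g z`.
  obtain ⟨R, hR, hRφ⟩ := exists_isEscapeRadius_of_eventually hg heq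
  filter_upwards [hχg, eventually_cobounded_le_norm R] with z hz hzR
  rw [hRφ z hzR, hRφ _ (by linarith [hR.2 z hzR, norm_nonneg z]), hz]
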